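/- Let $A$ and $B$ be complex unital Banach algebras, both nonzero, and let $A\overline{\otimes}B$ be a Banach algebra that is the completion of the algebraic tensor product $A\otimes B$ with respect to a uniform crossnorm. That is, the norm is a (submultiplicative) algebra norm $\alpha$ on $A\otimes B$ such that $\alpha(x\otimes y)=\|x\|\,\|y\|$ for all $x\in A$, $y\in B$, and $\alpha((S\otimes T)u)\le\|S\|\,\|T\|\,\alpha(u)$ for all bounded linear operators $S$ on $A$, $T$ on $B$ and all $u\in A\otimes B$. For $K\subseteq\mathbb C$ let $\operatorname{iso}K$ be the set of isolated points of $K$ and $\operatorname{acc}K=K\setminus\operatorname{iso}K$. For an element $c$ of a unital Banach algebra with spectrum $\sigma(c)$, let $\Pi(c)\subseteq\operatorname{iso}\sigma(c)$ be the set of those isolated points of $\sigma(c)$ that are poles (of some order $p\ge 1$) of the resolvent function $\lambda\mapsto(\lambda-c)^{-1}$, and let $I(c)=\operatorname{iso}\sigma(c)\setminus\Pi(c)$. **Theorem.** Let $a\in A$ and $b\in B$. Then the following statements hold. (i) $\sigma(a)=\Pi(a)=\{0\}$ or $\sigma(b)=\Pi(b)=\{0\}$ if and only if $\sigma(a\otimes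 b)=\Pi(a\otimes b)=\{0\}$. (ii) Suppose that neither $a$ nor $b$ is nilpotent. Then $\sigma(a)=I(a)=\{0\}$ or $\sigma(b)=I(b)=\{0\}$ if and only if $\sigma(a\otimes b)=I(a\otimes b)=\{0\}$. (iii) If $0\in\Pi(a)$ and $b$ is invertible, or if $0\in\Pi(b)$ and $a$ is invertible, or if $0\in\Pi(a)\cap\Pi(b)$, then $0\in\Pi(a\otimes b)$. (iv) If $a$ is not nilpotent, $0\in\Pi(a)$ and $0\in I(b)$, then $0\in I(a\otimes b)$. Likewise, if $b$ is not nilpotent, $0\in\Pi(b)$ and $0\in I(a)$, then $0\in I(a\otimes b)$. (v) If $b$ is invertible and $0\in I(a)$, or if $a$ is invertible and $0\in I(b)$, then $0\in I(a\otimes b)$. (vi) If $0\in I(a)\cap I(b)$, then $0\in I(a\otimes b)$. (vii) If $\sigma(b)\neq\{0\}$ and $0\in\operatorname{acc}\sigma(a)$, or if $\sigma(a)\neq\{0\}$ and $0\in\operatorname{acc}\sigma(b)$, then $0\in\operatorname{acc}\sigma(a\otimes b)$. -/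

import Mathlib

open scoped TensorProduct
open Filter Topology

namespace TensorSpectrum

/-! ### Completed tensor product of two unital Banach algebras -/

section CompletedTensorProduct

universe u v

variable {A : Type u} {B : Type v} [NormedRing A] [NormedAlgebra ℂ A]
  [NormedRing B] [NormedAlgebra ℂ B]

/-- An algebra norm `α` on the algebraic tensor product `A ⊗ B` is a uniform crossnorm if
`α (a ⊗ b) = ‖a‖ ‖b‖`, and if for all bounded linear maps `S` on `A` and `T` on `B` the map
`S ⊗ T` is `α`-bounded with norm at most `‖S‖ ‖T‖`. -/
structure IsUniformCrossnorm (α : AlgebraNorm ℂ (A ⊗[ℂ] B)) : Prop where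
  cross : ∀ (a : A) (b : B), α (a ⊗ₜ[ℂ] b) = ‖a‖ * ‖b‖
  uniform : ∀ (S : A →L[ℂ] A) (T : B →L[ℂ] B) (x : A ⊗[ℂ] B),
    α (TensorProduct.map (S : A →ₗ[ℂ] A) (T : B →ₗ[ℂ] B) x) ≤ ‖S‖ * ‖T‖ * α x

/-- The algebraic tensor product `A ⊗ B`, regarded as an algebra normed by `α`. -/
def NormedTensor (_α : AlgebraNorm ℂ (A ⊗[ℂ] B)) : Type (max u v) := A ⊗[ℂ] B

noncomputable instance (α : AlgebraNorm ℂ (A ⊗[ℂ] B)) : NormedRing (NormedTensor α) :=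
  RingNorm.toNormedRing (R := A ⊗[ℂ] B) α.toRingNorm

noncomputable instance (α : AlgebraNorm ℂ (A ⊗[ℂ] B)) : NormedAlgebra ℂ (NormedTensor α) where
  __ := (inferInstance : Algebra ℂ (A ⊗[ℂ] B))
  norm_smul_le := fun c x => le_of_eq (map_smul_eq_mul α c (x : A ⊗[ℂ] B))

/-- The identity map from `A ⊗ B` to the same algebra, normed by `α`. -/
noncomputable def NormedTensor.of (α : AlgebraNorm ℂ (A ⊗[ℂ] B)) :
    (A ⊗[ℂ] B) ≃ₐ[ℂ] NormedTensor α :=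
  AlgEquiv.refl (R := ℂ) (A₁ := A ⊗[ℂ] B)

theorem NormedTensor.norm_of (α : AlgebraNorm ℂ (A ⊗[ℂ] B)) (x : A ⊗[ℂ] B) :
    ‖NormedTensor.of α x‖ = α x := rfl

/-- The Banach algebra obtained by completing `A ⊗ B` with respect to `α`. -/
abbrev CompletedTensor (α : AlgebraNorm ℂ (A ⊗[ℂ] B)) : Type (max u v) :=
  UniformSpace.Completion (NormedTensor α)

noncomputable instance (α : AlgebraNorm ℂ (A ⊗[ℂ] B)) : NormedAlgebra ℂ (CompletedTensor α) where
  norm_smul_le := norm_smul_le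

/-- The elementary tensor `a ⊗ b` as an element of the completed tensor product. -/
noncomputable def tmul (α : AlgebraNorm ℂ (A ⊗[ℂ] B)) (a : A) (b : B) : CompletedTensor α :=
  (NormedTensor.of α (a ⊗ₜ[ℂ] b) : CompletedTensor α)

end CompletedTensorProduct

/-! ### Isolated points, accumulation points and poles of the spectrum -/

/-- The isolated points of a set `K` of complex numbers. -/
def iso (K : Set ℂ) : Set ℂ := {z ∈ K | ¬ AccPt z (𝓟 K)}

/-- `acc K = K \ iso K`. -/
def acc (K : Set ℂ) : Set ℂ := K \ iso K

section Banach

variable {A : Type*} [NormedRing A] [NormedAlgebra ℂ A]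

/-- The isolated point `z` of `σ(a)` is a pole of order `p` of the resolvent function
`w ↦ (w - a)⁻¹`: the Laurent expansion of the resolvent around `z` starts with a nonzero multiple
of `(w - z)⁻ᵖ`, where `p ≥ 1`. -/
def IsPoleOfOrder (a : A) (z : ℂ) (p : ℕ) : Prop :=
  z ∈ iso (spectrum ℂ a) ∧ 1 ≤ p ∧ meromorphicOrderAt (resolvent a) z = ((-(p : ℤ) : ℤ) : WithTop ℤ)

/-- `Π(a)`, the set of poles of `a`. -/
def poles (a : A) : Set ℂ := {z | ∃ p : ℕ, IsPoleOfOrder a z p}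

/-- `I(a)`, the set of isolated points of `σ(a)` that are not poles. -/
def nonpoles (a : A) : Set ℂ := iso (spectrum ℂ a) \ poles a

end Banach

end TensorSpectrum

/-!
For noninvertible `a`, the resolvent has a pole at `0` exactly when `a` is strongly π-regular, that
is, when both chains `aⁿA` and `Aaⁿ` stabilise: the Laurent coefficients of the resolvent produce
solutions of `aⁿ⁺¹y = aⁿ = zaⁿ⁺¹`, and conversely these give a finite geometric expansion of the
resolvent. The property passes from `a` and `b` to `a ⊗ b`. In the other direction, if
`g (bⁿ) = 1`, then the slice map `id ⊗ g`, which is bounded because the norm is a uniform crossnorm,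
carries the equations for `a ⊗ b` to equations for `a`.

Moreover `σ(a ⊗ b) = σ(a) σ(b)`. The inclusion `⊆` follows by applying the characters of the
bicommutant of `{a ⊗ 1, 1 ⊗ b}`. For `⊇`, a nonzero product of spectral points can be written as
`l m` with `l` or `m` on the frontier of its spectrum. If it is `m`, there is an approximate
eigenvector `y` of `b` at `m`, and slicing along a norming functional of `y` turns an inverse of
`l m - a ⊗ b` into an inverse of `l - a`.
-/

namespace TensorSpectrum

open scoped Pointwise

/-! ### Strongly π-regular elements -/

section StronglyPiRegular

variable {R : Type*}

/-- An element is strongly π-regular if the descending chains `aⁿR` and `Raⁿ` both stabilise.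
Such elements are also called Drazin invertible. -/
def IsStronglyPiRegular [Monoid R] (a : R) : Prop :=
  ∃ (n : ℕ) (y z : R), a ^ (n + 1) * y = a ^ n ∧ z * a ^ (n + 1) = a ^ n

theorem pow_succ_mul_of_le [Monoid R] {a y : R} {n m : ℕ} (h : a ^ (n + 1) * y = a ^ n)
    (hnm : n ≤ m) : a ^ (m + 1) * y = a ^ m := by
  obtain ⟨k, rfl⟩ := Nat.exists_eq_add_of_le' hnm
  rw [add_assoc, pow_add, mul_assoc, h, ← pow_add]

theorem mul_pow_succ_of_le [Monoid R] {a z : R} {n m : ℕ} (h : z * a ^ (n + 1) = a ^ n)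
    (hnm : n ≤ m) : z * a ^ (m + 1) = a ^ m := by
  obtain ⟨k, rfl⟩ := Nat.exists_eq_add_of_le hnm
  rw [add_right_comm, pow_add, ← mul_assoc, h, ← pow_add]

theorem pow_add_mul_pow [Monoid R] {a y : R} {n : ℕ} (h : a ^ (n + 1) * y = a ^ n) (k : ℕ) :
    a ^ (n + k) * y ^ k = a ^ n := by
  induction k with
  | zero => simp
  | succ k ih =>
    rw [pow_succ', ← mul_assoc, ← add_assoc, pow_succ_mul_of_le h (Nat.le_add_right n k), ih]

theorem pow_mul_pow_add [Monoid R] {a z : R} {n : ℕ} (h : z * a ^ (n + 1) = a ^ n) (k : ℕ) :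
    z ^ k * a ^ (n + k) = a ^ n := by
  induction k with
  | zero => simp
  | succ k ih =>
    rw [pow_succ, mul_assoc, ← add_assoc, mul_pow_succ_of_le h (Nat.le_add_right n k), ih]

theorem IsStronglyPiRegular.exists_commute [Monoid R] {a : R} (ha : IsStronglyPiRegular a) :
    ∃ (n : ℕ) (x : R), Commute a x ∧ a ^ (n + 1) * x = a ^ n := by
  obtain ⟨n, y, z, hy, hz⟩ := ha
  have hswap (k : ℕ) : a ^ n * y ^ k = z ^ k * a ^ n := by
    calc a ^ n * y ^ k = z ^ k * a ^ (n + k) * y ^ k := by rw [pow_mul_pow_add hz]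
      _ = z ^ k * a ^ n := by rw [mul_assoc, pow_add_mul_pow hy]
  refine ⟨n, a ^ n * y ^ (n + 1), ?_, ?_⟩
  · calc a * (a ^ n * y ^ (n + 1)) = a ^ n * y ^ n := by
          rw [← mul_assoc, ← pow_succ', pow_succ' y, ← mul_assoc, hy]
      _ = z ^ n * (z * a ^ (n + 1)) := by rw [hz, hswap]
      _ = a ^ n * y ^ (n + 1) * a := by rw [hswap, pow_succ z, pow_succ a]; simp only [mul_assoc]
  · rw [← mul_assoc, ← pow_add, add_comm (n + 1) n, pow_add_mul_pow hy]

theorem isStronglyPiRegular_of_commute [Monoid R] {a x : R} {n : ℕ} (hx : Commute a x)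
    (h : a ^ (n + 1) * x = a ^ n) : IsStronglyPiRegular a :=
  ⟨n, x, x, h, by rw [← (hx.pow_left _).eq, h]⟩

theorem isStronglyPiRegular_of_isUnit [Monoid R] {a : R} (ha : IsUnit a) :
    IsStronglyPiRegular a := by
  obtain ⟨u, rfl⟩ := ha
  exact ⟨0, ↑u⁻¹, ↑u⁻¹, by simp, by simp⟩

theorem isStronglyPiRegular_of_isNilpotent [MonoidWithZero R] {a : R} (ha : IsNilpotent a) :
    IsStronglyPiRegular a := by
  obtain ⟨n, hn⟩ := ha
  exact ⟨n, 0, 0, by simp [hn], by simp [hn]⟩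

end StronglyPiRegular

/-! ### Poles of the resolvent -/

theorem not_accPt_principal_iff {X : Type*} [TopologicalSpace X] {x : X} {K : Set X} :
    ¬ AccPt x (𝓟 K) ↔ ∀ᶠ y in 𝓝[≠] x, y ∉ K := by
  rw [accPt_iff_frequently_nhdsNE, not_frequently]

section Algebra

variable {R A : Type*} [CommRing R] [Ring A] [Algebra R A] {a : A} {z : R}

theorem sub_mul_resolvent (hz : z ∉ spectrum R a) :
    (algebraMap R A z - a) * resolvent a z = 1 :=
  Ring.mul_inverse_cancel _ (spectrum.notMem_iff.mp hz)

theorem resolvent_mul_sub (hz : z ∉ spectrum R a) :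
    resolvent a z * (algebraMap R A z - a) = 1 :=
  Ring.inverse_mul_cancel _ (spectrum.notMem_iff.mp hz)

theorem sub_algebraMap_mul_resolvent (hz : z ∉ spectrum R a) (w : R) :
    (a - algebraMap R A w) * resolvent a z = (z - w) • resolvent a z - 1 := by
  have hsplit : a - algebraMap R A w = (z - w) • 1 - (algebraMap R A z - a) := by
    rw [← Algebra.algebraMap_eq_smul_one, map_sub]; abel
  rw [hsplit, sub_mul, sub_mul_resolvent hz, smul_one_mul]

theorem resolvent_mul_sub_algebraMap (hz : z ∉ spectrum R a) (w : R) :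
    resolvent a z * (a - algebraMap R A w) = (z - w) • resolvent a z - 1 := by
  have hsplit : a - algebraMap R A w = (z - w) • 1 - (algebraMap R A z - a) := by
    rw [← Algebra.algebraMap_eq_smul_one, map_sub]; abel
  rw [hsplit, mul_sub, resolvent_mul_sub hz, mul_smul_one]

end Algebra

section Resolvent

variable {A : Type*} [NormedRing A] [NormedAlgebra ℂ A] {a : A} {z z₀ : ℂ}

theorem one_le_norm_sub_mul_norm_resolvent [CompleteSpace A] (hz₀ : z₀ ∈ spectrum ℂ a)
    (hz : z ∉ spectrum ℂ a) : 1 ≤ ‖z - z₀‖ * ‖resolvent a z‖ := by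
  by_contra! hlt
  rw [← norm_smul] at hlt
  have hfactor : algebraMap ℂ A z₀ - a =
      (algebraMap ℂ A z - a) * (1 - (z - z₀) • resolvent a z) := by
    rw [mul_sub, mul_one, mul_smul_comm, sub_mul_resolvent hz, ← Algebra.algebraMap_eq_smul_one,
      map_sub]
    abel
  refine hz₀ (?_ : IsUnit _)
  rw [hfactor]
  exact (spectrum.notMem_iff.mp hz).mul (Units.oneSub _ hlt).isUnit

theorem meromorphicOrderAt_resolvent_neg [CompleteSpace A] (hz₀ : z₀ ∈ iso (spectrum ℂ a))
    (hmer : MeromorphicAt (resolvent a) z₀) : meromorphicOrderAt (resolvent a) z₀ < 0 := by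
  rw [← tendsto_cobounded_iff_meromorphicOrderAt_neg hmer, ← tendsto_norm_atTop_iff_cobounded]
  have hblow : Tendsto (fun z => ‖z - z₀‖⁻¹) (𝓝[≠] z₀) atTop :=
    (tendsto_norm_sub_self_nhdsNE z₀).inv_tendsto_nhdsGT_zero
  refine tendsto_atTop_mono' _ ?_ hblow
  filter_upwards [not_accPt_principal_iff.mp hz₀.2, self_mem_nhdsWithin] with z hz hne
  exact (inv_le_iff_one_le_mul₀' (norm_pos_iff.mpr (sub_ne_zero.mpr hne))).mpr
    (one_le_norm_sub_mul_norm_resolvent hz₀.1 hz)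

theorem mem_poles_iff_meromorphicAt [CompleteSpace A] :
    z₀ ∈ poles a ↔ z₀ ∈ iso (spectrum ℂ a) ∧ MeromorphicAt (resolvent a) z₀ := by
  constructor
  · rintro ⟨p, hiso, hp, hord⟩
    exact ⟨hiso, meromorphicAt_of_meromorphicOrderAt_ne_zero (by rw [hord]; norm_cast; omega)⟩
  · rintro ⟨hiso, hmer⟩
    have hneg := meromorphicOrderAt_resolvent_neg hiso hmer
    obtain ⟨m, hm⟩ := WithTop.ne_top_iff_exists.mp hneg.ne_top
    have hm0 : m < 0 := by rw [← hm] at hneg; exact_mod_cast hneg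
    exact ⟨m.natAbs, hiso, by omega, by rw [← hm]; congr 1; omega⟩

/-- The integral `(2πi)⁻¹ ∮ (z - z₀)ᵏ (z - a)⁻¹ dz` over the circle of radius `r` around `z₀`. If
`σ(a)` meets the closed disc at most in its centre `z₀`, this is the coefficient of
`(z - z₀)^(-k - 1)` in the Laurent expansion of the resolvent. -/
noncomputable def laurentIntegral (a : A) (z₀ : ℂ) (r : ℝ) (k : ℤ) : A :=
  (2 * Real.pi * Complex.I : ℂ)⁻¹ • ∮ z in C(z₀, r), (z - z₀) ^ k • resolvent a z

theorem continuousOn_resolvent [CompleteSpace A] (a : A) :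
    ContinuousOn (resolvent a : ℂ → A) (resolventSet ℂ a) := fun _ hz =>
  (spectrum.hasDerivAt_resolvent_const_left hz).continuousAt.continuousWithinAt

theorem circleIntegrable_zpow_smul_resolvent [CompleteSpace A] {r : ℝ} (hr : 0 < r)
    (hsphere : Metric.sphere z₀ r ⊆ resolventSet ℂ a) (k : ℤ) :
    CircleIntegrable (fun z => (z - z₀) ^ k • resolvent a z) z₀ r := by
  refine ContinuousOn.circleIntegrable hr.le
    (ContinuousOn.smul ?_ ((continuousOn_resolvent a).mono hsphere))
  exact (continuousOn_id.sub continuousOn_const).zpow₀ k fun z hz =>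
    Or.inl (sub_ne_zero.mpr (Metric.ne_of_mem_sphere hz hr.ne'))

theorem circleIntegral_clm_comp {E F : Type*} [NormedAddCommGroup E] [NormedSpace ℂ E]
    [CompleteSpace E] [NormedAddCommGroup F] [NormedSpace ℂ F] [CompleteSpace F] (L : E →L[ℂ] F)
    {f : ℂ → E} {r : ℝ} (hf : CircleIntegrable f z₀ r) :
    (∮ z in C(z₀, r), L (f z)) = L (∮ z in C(z₀, r), f z) := by
  simp only [circleIntegral, ← map_smul]
  exact L.intervalIntegral_comp_comm hf.out

theorem circleIntegral_zpow {r : ℝ} (hr : r ≠ 0) (k : ℤ) :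
    (∮ z in C(z₀, r), (z - z₀) ^ k) = if k = -1 then 2 * Real.pi * Complex.I else 0 := by
  split_ifs with hk
  · simpa only [hk, zpow_neg_one] using circleIntegral.integral_sub_center_inv z₀ hr
  · exact circleIntegral.integral_sub_zpow_of_ne hk z₀ z₀ r

theorem map_laurentIntegral [CompleteSpace A] (L : A →L[ℂ] A)
    (hL : ∀ z ∉ spectrum ℂ a, L (resolvent a z) = (z - z₀) • resolvent a z - 1) {r : ℝ}
    (hr : 0 < r) (hsphere : Metric.sphere z₀ r ⊆ resolventSet ℂ a) (k : ℤ) :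
    L (laurentIntegral a z₀ r k) = laurentIntegral a z₀ r (k + 1) - if k = -1 then 1 else 0 := by
  have hint := circleIntegrable_zpow_smul_resolvent hr hsphere
  have hne {z : ℂ} (hz : z ∈ Metric.sphere z₀ r) : z - z₀ ≠ 0 :=
    sub_ne_zero.mpr (Metric.ne_of_mem_sphere hz hr.ne')
  have hzpow : CircleIntegrable (fun z => (z - z₀) ^ k • (1 : A)) z₀ r :=
    ContinuousOn.circleIntegrable hr.le <| ContinuousOn.smul
      ((continuousOn_id.sub continuousOn_const).zpow₀ k fun z hz => Or.inl (hne hz))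
      continuousOn_const
  have hintegrand : Set.EqOn (fun z => L ((z - z₀) ^ k • resolvent a z))
      (fun z => (z - z₀) ^ (k + 1) • resolvent a z - (z - z₀) ^ k • (1 : A))
      (Metric.sphere z₀ r) := fun z hz => by
    simp only [map_smul, hL z (fun h => h (hsphere hz)), smul_sub, smul_smul,
      zpow_add_one₀ (hne hz)]
  rw [laurentIntegral, map_smul, ← circleIntegral_clm_comp L (hint k),
    circleIntegral.integral_congr hr.le hintegrand,
    circleIntegral.integral_sub (hint (k + 1)) hzpow, circleIntegral.integral_smul_const,
    circleIntegral_zpow hr.ne', smul_sub, laurentIntegral]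
  split_ifs
  · rw [inv_smul_smul₀ Complex.two_pi_I_ne_zero]
  · rw [zero_smul, smul_zero]

theorem sub_mul_laurentIntegral [CompleteSpace A] {r : ℝ} (hr : 0 < r)
    (hsphere : Metric.sphere z₀ r ⊆ resolventSet ℂ a) (k : ℤ) :
    (a - algebraMap ℂ A z₀) * laurentIntegral a z₀ r k =
      laurentIntegral a z₀ r (k + 1) - if k = -1 then 1 else 0 :=
  map_laurentIntegral (ContinuousLinearMap.mul ℂ A (a - algebraMap ℂ A z₀))
    (fun _ hz => sub_algebraMap_mul_resolvent hz z₀) hr hsphere k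

theorem laurentIntegral_mul_sub [CompleteSpace A] {r : ℝ} (hr : 0 < r)
    (hsphere : Metric.sphere z₀ r ⊆ resolventSet ℂ a) (k : ℤ) :
    laurentIntegral a z₀ r k * (a - algebraMap ℂ A z₀) =
      laurentIntegral a z₀ r (k + 1) - if k = -1 then 1 else 0 :=
  map_laurentIntegral ((ContinuousLinearMap.mul ℂ A).flip (a - algebraMap ℂ A z₀))
    (fun _ hz => resolvent_mul_sub_algebraMap hz z₀) hr hsphere k

theorem pow_mul_laurentIntegral_zero [CompleteSpace A] {r : ℝ} (hr : 0 < r)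
    (hsphere : Metric.sphere z₀ r ⊆ resolventSet ℂ a) (p : ℕ) :
    (a - algebraMap ℂ A z₀) ^ p * laurentIntegral a z₀ r 0 = laurentIntegral a z₀ r p := by
  induction p with
  | zero => simp
  | succ p ih =>
    rw [pow_succ', mul_assoc, ih, sub_mul_laurentIntegral hr hsphere, if_neg (by omega), sub_zero,
      Nat.cast_succ]

/-- The Laurent coefficients of the resolvent satisfy `c₀ = 1 + (a - z₀) c₋₁`, and at a pole of
order at most `p` also `(a - z₀)ᵖ c₀ = cₚ = 0`. -/
theorem isStronglyPiRegular_sub_of_laurentIntegral_eq_zero [CompleteSpace A] {r : ℝ} (hr : 0 < r)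
    (hsphere : Metric.sphere z₀ r ⊆ resolventSet ℂ a) {p : ℕ}
    (hp : laurentIntegral a z₀ r p = 0) : IsStronglyPiRegular (a - algebraMap ℂ A z₀) := by
  set d := a - algebraMap ℂ A z₀
  set c := laurentIntegral a z₀ r (-1)
  have hc : d * c = laurentIntegral a z₀ r 0 - 1 := sub_mul_laurentIntegral hr hsphere (-1)
  have hcomm : Commute d c :=
    (sub_mul_laurentIntegral hr hsphere (-1)).trans (laurentIntegral_mul_sub hr hsphere (-1)).symm
  have hpow : d ^ p * laurentIntegral a z₀ r 0 = 0 :=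
    (pow_mul_laurentIntegral_zero hr hsphere p).trans hp
  refine isStronglyPiRegular_of_commute (n := p) hcomm.neg_right ?_
  rw [mul_neg, pow_succ, mul_assoc, hc, mul_sub, hpow, mul_one, zero_sub, neg_neg]

theorem laurentIntegral_eq_zero {r : ℝ} (hr : 0 < r) {k : ℤ} {G : ℂ → A}
    (hG : DifferentiableOn ℂ G (Metric.closedBall z₀ r))
    (hGr : Set.EqOn G (fun z => (z - z₀) ^ k • resolvent a z) (Metric.sphere z₀ r)) :
    laurentIntegral a z₀ r k = 0 := by
  rw [laurentIntegral, ← circleIntegral.integral_congr hr.le hGr,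
    (hG.diffContOnCl_ball subset_rfl).circleIntegral_eq_zero hr.le, smul_zero]

theorem isStronglyPiRegular_sub_of_mem_poles [CompleteSpace A] (h : z₀ ∈ poles a) :
    IsStronglyPiRegular (a - algebraMap ℂ A z₀) := by
  obtain ⟨p, hiso, hp, hord⟩ := h
  have hmer : MeromorphicAt (resolvent a) z₀ :=
    (mem_poles_iff_meromorphicAt.mp ⟨p, hiso, hp, hord⟩).2
  obtain ⟨G, hG, -, hGr⟩ := (meromorphicOrderAt_eq_int_iff hmer).mp hord
  obtain ⟨r, hr, hball⟩ : ∃ r > 0, ∀ z ∈ Metric.closedBall z₀ r, AnalyticAt ℂ G z ∧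
      (z ≠ z₀ → resolvent a z = (z - z₀) ^ (-(p : ℤ)) • G z ∧ z ∉ spectrum ℂ a) :=
    Metric.nhds_basis_closedBall.eventually_iff.mp <| hG.eventually_analyticAt.and <|
      eventually_nhdsWithin_iff.mp (hGr.and (not_accPt_principal_iff.mp hiso.2))
  have hsphere {z : ℂ} (hz : z ∈ Metric.sphere z₀ r) :
      resolvent a z = (z - z₀) ^ (-(p : ℤ)) • G z ∧ z ∉ spectrum ℂ a :=
    (hball z (Metric.sphere_subset_closedBall hz)).2 (Metric.ne_of_mem_sphere hz hr.ne')
  refine isStronglyPiRegular_sub_of_laurentIntegral_eq_zero hr (p := p)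
    (fun z hz => spectrum.notMem_iff.mp (hsphere hz).2) (laurentIntegral_eq_zero hr
      (fun z hz => (hball z hz).1.differentiableAt.differentiableWithinAt) fun z hz => ?_)
  have hne : z - z₀ ≠ 0 := sub_ne_zero.mpr (Metric.ne_of_mem_sphere hz hr.ne')
  simp only [(hsphere hz).1, smul_smul, ← zpow_add₀ hne, add_neg_cancel, zpow_zero, one_smul]

theorem sub_mul_geom_sum_sub {R S : Type*} [CommRing R] [Ring S] [Algebra R S] {d y v : S}
    {n : ℕ} (hy : d ^ (n + 1) * y = d ^ n) {w : R} (hv : (1 - w • y) * v = 1) :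
    (algebraMap R S w - d) *
      (∑ i ∈ Finset.range n, algebraMap R S w ^ i * d ^ (n - 1 - i) - d ^ n * y * v) =
      w ^ n • 1 := by
  have htail : (algebraMap R S w - d) * (d ^ n * y) = -(d ^ n * (1 - w • y)) := by
    rw [sub_mul, ← mul_assoc d, ← pow_succ', hy, ← Algebra.smul_def, mul_sub, mul_smul_comm,
      mul_one, neg_sub]
  rw [mul_sub, (Algebra.commute_algebraMap_left w d).mul_geom_sum₂, ← mul_assoc, htail, neg_mul,
    mul_assoc, hv, mul_one, sub_neg_eq_add, sub_add_cancel, ← map_pow,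
    Algebra.algebraMap_eq_smul_one]

theorem eq_smul_ringInverse {R S : Type*} [Field R] [Ring S] [Algebra R S] {s l : S} {c : R}
    (hc : c ≠ 0) (h : s * l = c • 1) (hcomm : Commute s l) :
    IsUnit s ∧ Ring.inverse s = c⁻¹ • l := by
  have hright : s * (c⁻¹ • l) = 1 := by rw [mul_smul_comm, h, inv_smul_smul₀ hc]
  have hleft : c⁻¹ • l * s = 1 := by rw [← (hcomm.smul_right c⁻¹).eq, hright]
  exact ⟨⟨⟨s, _, hright, hleft⟩, rfl⟩, Ring.inverse_unit ⟨s, _, hright, hleft⟩⟩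

theorem exists_resolvent_eq_of_isStronglyPiRegular [CompleteSpace A]
    (h : IsStronglyPiRegular (a - algebraMap ℂ A z₀)) :
    ∃ (n : ℕ) (L : ℂ → A), AnalyticAt ℂ L z₀ ∧
      ∀ᶠ z in 𝓝[≠] z₀, z ∉ spectrum ℂ a ∧ resolvent a z = ((z - z₀) ^ n)⁻¹ • L z := by
  set d := a - algebraMap ℂ A z₀ with hd
  obtain ⟨n, y, hdy, hy⟩ := h.exists_commute
  let u (z : ℂ) : A := 1 - (z - z₀) • y
  let L (z : ℂ) : A := ∑ i ∈ Finset.range n, algebraMap ℂ A (z - z₀) ^ i * d ^ (n - 1 - i) -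
    d ^ n * y * Ring.inverse (u z)
  have hu₀ : u z₀ = (1 : Aˣ) := by simp [u]
  have hu : AnalyticAt ℂ u z₀ := by fun_prop
  have hinv : AnalyticAt ℂ (fun z => Ring.inverse (u z)) z₀ :=
    (hu₀ ▸ analyticAt_inverse (1 : Aˣ) : AnalyticAt ℂ Ring.inverse (u z₀)).comp hu
  have halg : AnalyticAt ℂ (fun z => algebraMap ℂ A (z - z₀)) z₀ :=
    (algebraMapCLM ℂ A).analyticAt _ |>.comp (by fun_prop)
  have hL : AnalyticAt ℂ L z₀ := by fun_prop
  refine ⟨n, L, hL, ?_⟩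
  have hunit : ∀ᶠ z in 𝓝[≠] z₀, IsUnit (u z) :=
    (hu.continuousAt.eventually (Units.isOpen.mem_nhds ⟨1, hu₀.symm⟩)).filter_mono
      nhdsWithin_le_nhds
  filter_upwards [hunit, self_mem_nhdsWithin] with z hz hne
  have hsub : algebraMap ℂ A (z - z₀) - d = algebraMap ℂ A z - a := by rw [hd, map_sub]; abel
  have hcomm : Commute d (L z) := by
    have hdz := Algebra.commute_algebraMap_right (z - z₀) d
    have hdu : Commute d (u z) := (Commute.one_right d).sub_right (hdy.smul_right _)
    have hdinv : Commute d (Ring.inverse (u z)) := by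
      obtain ⟨v, hv⟩ := hz
      rw [← hv] at hdu ⊢
      rw [Ring.inverse_unit]
      exact hdu.units_inv_right
    exact (Commute.sum_right _ _ _ fun i _ => (hdz.pow_right i).mul_right
      (Commute.self_pow d _)).sub_right (((Commute.self_pow d n).mul_right hdy).mul_right hdinv)
  obtain ⟨hunit', hres⟩ := eq_smul_ringInverse (pow_ne_zero n (sub_ne_zero.mpr hne))
    (sub_mul_geom_sum_sub hy (Ring.mul_inverse_cancel _ hz))
    ((Algebra.commute_algebraMap_left _ _).sub_left hcomm)
  rw [hsub] at hunit' hres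
  exact ⟨spectrum.notMem_iff.mpr hunit', hres⟩

theorem mem_poles_iff [CompleteSpace A] :
    z₀ ∈ poles a ↔ z₀ ∈ spectrum ℂ a ∧ IsStronglyPiRegular (a - algebraMap ℂ A z₀) := by
  refine ⟨fun h => ⟨?_, isStronglyPiRegular_sub_of_mem_poles h⟩, fun ⟨hz₀, h⟩ => ?_⟩
  · exact (mem_poles_iff_meromorphicAt.mp h).1.1
  · obtain ⟨n, L, hL, hres⟩ := exists_resolvent_eq_of_isStronglyPiRegular h
    have hmer : MeromorphicAt (fun z => ((z - z₀) ^ n)⁻¹ • L z) z₀ :=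
      (((MeromorphicAt.id z₀).sub (MeromorphicAt.const z₀ z₀)).pow n).inv.smul hL.meromorphicAt
    exact mem_poles_iff_meromorphicAt.mpr
      ⟨⟨hz₀, not_accPt_principal_iff.mpr (hres.mono fun _ h => h.1)⟩,
        hmer.congr (hres.mono fun _ h => h.2.symm)⟩

theorem zero_mem_poles_iff [CompleteSpace A] :
    0 ∈ poles a ↔ ¬ IsUnit a ∧ IsStronglyPiRegular a := by
  rw [mem_poles_iff, spectrum.zero_mem_iff, map_zero, sub_zero]

end Resolvent

/-! ### The spectrum of a commuting product -/

section SetLemmas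

variable {𝕜 : Type*} [NormedField 𝕜] {K L : Set 𝕜}

theorem not_accPt_zero_iff : ¬ AccPt 0 (𝓟 K) ↔ ∃ ε > 0, ∀ z ∈ K, z ≠ 0 → ε ≤ ‖z‖ := by
  simp only [not_accPt_principal_iff, eventually_nhdsWithin_iff, Metric.eventually_nhds_iff,
    dist_zero_right]
  refine exists_congr fun ε => and_congr_right fun _ => forall_congr' fun z => ?_
  rw [← not_lt, Set.mem_compl_singleton_iff]
  tauto

theorem not_accPt_zero_mul (hK : ¬ AccPt 0 (𝓟 K)) (hL : ¬ AccPt 0 (𝓟 L)) :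
    ¬ AccPt 0 (𝓟 (K * L)) := by
  rw [not_accPt_zero_iff] at *
  obtain ⟨ε, hε, hK⟩ := hK
  obtain ⟨δ, hδ, hL⟩ := hL
  refine ⟨ε * δ, mul_pos hε hδ, ?_⟩
  rintro _ ⟨l, hl, m, hm, rfl⟩ hne
  rw [norm_mul]
  exact mul_le_mul (hK l hl (left_ne_zero_of_mul hne)) (hL m hm (right_ne_zero_of_mul hne)) hδ.le
    (norm_nonneg l)

theorem accPt_zero_mul {m : 𝕜} (hK : AccPt 0 (𝓟 K)) (hm : m ∈ L) (hm0 : m ≠ 0) :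
    AccPt 0 (𝓟 (K * L)) := by
  have h := hK.map (f := fun z => z * m) (continuousAt_id.mul continuousAt_const)
    (mul_left_injective₀ hm0)
  rw [map_principal, zero_mul] at h
  exact h.mono (principal_mono.mpr (Set.image_subset_iff.mpr fun z hz => Set.mul_mem_mul hz hm))

theorem exists_mem_ne_zero (hK : K.Nonempty) (h : K ≠ {0}) : ∃ z ∈ K, z ≠ 0 := by
  by_contra! hcon
  exact h (hK.subset_singleton_iff.mp hcon)

theorem mul_eq_singleton_zero_iff (hK : K.Nonempty) (hL : L.Nonempty) :
    K * L = {0} ↔ K = {0} ∨ L = {0} := by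
  refine ⟨fun h => ?_, ?_⟩
  · by_contra! hcon
    obtain ⟨l, hl, hl0⟩ := exists_mem_ne_zero hK hcon.1
    obtain ⟨m, hm, hm0⟩ := exists_mem_ne_zero hL hcon.2
    exact mul_ne_zero hl0 hm0 (h ▸ Set.mul_mem_mul hl hm : l * m ∈ ({0} : Set 𝕜))
  · rintro (rfl | rfl)
    · exact hL.zero_mul
    · exact hK.mul_zero

theorem mem_acc_iff {K : Set ℂ} {z : ℂ} : z ∈ acc K ↔ z ∈ K ∧ AccPt z (𝓟 K) := by
  simp only [acc, iso, Set.mem_sdiff, Set.mem_ofPred_eq]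
  tauto

theorem iso_singleton (z : ℂ) : iso {z} = {z} := by
  refine Set.sep_eq_self_iff_mem_true.mpr ?_
  rintro w rfl
  exact not_accPt_principal_iff.mpr self_mem_nhdsWithin

end SetLemmas

theorem apply_mem_spectrum_of_centralizer {R A : Type*} [CommRing R] [Nontrivial R] [Ring A]
    [Algebra R A] {s : Set A} (f : Subalgebra.centralizer R s →ₐ[R] R)
    (x : Subalgebra.centralizer R s) : f x ∈ spectrum R (x : A) := by
  rintro ⟨u, hu : (u : A) = algebraMap R A (f x) - x⟩
  have hinv : ((u⁻¹ : Aˣ) : A) ∈ Subalgebra.centralizer R s := fun t ht => by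
    have hut : Commute t (u : A) := hu ▸ (algebraMap R _ (f x) - x).2 t ht
    exact hut.units_inv_right
  have hmul : (algebraMap R _ (f x) - x) * ⟨_, hinv⟩ = 1 :=
    Subtype.ext (by simp [← hu])
  simpa using congrArg f hmul

theorem poles_subset_iso {A : Type*} [NormedRing A] [NormedAlgebra ℂ A] (a : A) :
    poles a ⊆ iso (spectrum ℂ a) := fun _ ⟨_, h⟩ => h.1

section Spectrum

variable {A : Type*} [NormedRing A] [NormedAlgebra ℂ A] [CompleteSpace A] {a b : A}

theorem spectrum_mul_subset (hab : Commute a b) :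
    spectrum ℂ (a * b) ⊆ spectrum ℂ a * spectrum ℂ b := by
  intro z hz
  let s : Set A := {a, b}
  let S : Subalgebra ℂ A := Subalgebra.centralizer ℂ s.centralizer
  have hsS : s ⊆ S := Set.subset_centralizer_centralizer
  have hs : ∀ x ∈ s, ∀ y ∈ s, x * y = y * x := by
    rintro x (rfl | rfl) y (rfl | rfl)
    exacts [rfl, hab.eq, hab.eq.symm, rfl]
  have : CompleteSpace S := (Set.isClosed_centralizer s.centralizer).completeSpace_coe
  let : NormedCommRing S :=
    { (inferInstance : NormedRing S) with
      mul_comm := fun x y => Subtype.ext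
        (Set.centralizer_centralizer_comm_of_comm hs _ x.2 _ y.2) }
  let : NormedAlgebra ℂ S := Subalgebra.toNormedAlgebra S
  let a' : S := ⟨a, hsS (Set.mem_insert a {b})⟩
  let b' : S := ⟨b, hsS (Set.mem_insert_of_mem a rfl)⟩
  obtain ⟨f, hf⟩ := WeakDual.CharacterSpace.mem_spectrum_iff_exists.mp
    (spectrum.subset_subalgebra (a' * b') hz)
  let f' : S →ₐ[ℂ] ℂ := WeakDual.CharacterSpace.toAlgHom f
  exact ⟨f' a', apply_mem_spectrum_of_centralizer f' a', f' b',
    apply_mem_spectrum_of_centralizer f' b', (map_mul f' a' b').symm.trans hf⟩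

theorem not_accPt_zero_spectrum_of_isUnit (ha : IsUnit a) : ¬ AccPt 0 (𝓟 (spectrum ℂ a)) := by
  rw [not_accPt_principal_iff]
  exact mem_nhdsWithin_of_mem_nhds ((spectrum.isClosed a).isOpen_compl.mem_nhds
    ((spectrum.zero_notMem_iff ℂ).mpr ha))

theorem spectrum_eq_zero_of_isNilpotent [Nontrivial A] (ha : IsNilpotent a) :
    spectrum ℂ a = {0} := by
  refine (spectrum.nonempty a).subset_singleton_iff.mp fun z hz => ?_
  obtain ⟨n, hn⟩ := ha
  have := spectrum.pow_mem_pow a n hz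
  rw [hn, spectrum.zero_eq] at this
  exact eq_zero_of_pow_eq_zero this

theorem IsStronglyPiRegular.isNilpotent_of_spectrum_eq_zero (ha : IsStronglyPiRegular a)
    (h : spectrum ℂ a = {0}) : IsNilpotent a := by
  obtain ⟨n, x, hx, hn⟩ := ha.exists_commute
  have hu : IsUnit (1 - a * x) := by
    have h1 : (1 : ℂ) ∉ spectrum ℂ (a * x) := fun h1 => by
      obtain ⟨l, hl, m, -, hlm⟩ := spectrum_mul_subset hx h1
      rw [h] at hl
      simp [Set.mem_singleton_iff.mp hl] at hlm
    simpa using spectrum.notMem_iff.mp h1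
  refine ⟨n, hu.mul_left_eq_zero.mp ?_⟩
  rw [mul_sub, mul_one, ← mul_assoc, ← pow_succ, hn, sub_self]

theorem isNilpotent_iff_spectrum_and_poles_eq_zero [Nontrivial A] :
    IsNilpotent a ↔ spectrum ℂ a = {0} ∧ poles a = {0} := by
  refine ⟨fun ha => ?_, fun ⟨hσ, hp⟩ => ?_⟩
  · have hσ := spectrum_eq_zero_of_isNilpotent ha
    have hp : 0 ∈ poles a :=
      zero_mem_poles_iff.mpr ⟨ha.not_isUnit, isStronglyPiRegular_of_isNilpotent ha⟩
    have hsub : poles a ⊆ {0} := by simpa only [hσ, iso_singleton] using poles_subset_iso a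
    exact ⟨hσ, hsub.antisymm (Set.singleton_subset_iff.mpr hp)⟩
  · exact (zero_mem_poles_iff.mp (hp.symm.subset rfl)).2.isNilpotent_of_spectrum_eq_zero hσ

theorem spectrum_eq_zero_and_nonpoles_eq_zero_iff (ha : ¬ IsNilpotent a) :
    spectrum ℂ a = {0} ∧ nonpoles a = {0} ↔ spectrum ℂ a = {0} := by
  refine and_iff_left_of_imp fun hσ => ?_
  have hp : 0 ∉ poles a := fun h =>
    ha ((zero_mem_poles_iff.mp h).2.isNilpotent_of_spectrum_eq_zero hσ)
  rw [nonpoles, hσ, iso_singleton]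
  exact sdiff_eq_left.mpr (Set.disjoint_singleton_left.mpr hp)

theorem not_isNilpotent_of_zero_mem_nonpoles (h : 0 ∈ nonpoles a) : ¬ IsNilpotent a := fun ha =>
  h.2 (zero_mem_poles_iff.mpr
    ⟨(spectrum.zero_mem_iff ℂ).mp h.1.1, isStronglyPiRegular_of_isNilpotent ha⟩)

end Spectrum

section ApproximateEigenvector

variable {A : Type*} [NormedRing A] [NormedAlgebra ℂ A] [CompleteSpace A] {a : A} {z z₀ : ℂ}

theorem norm_smul_resolvent_sub_one_le (hz₀ : z₀ ∈ spectrum ℂ a) (hz : z ∉ spectrum ℂ a) :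
    ‖(z - z₀) • resolvent a z - 1‖ ≤ ‖z - z₀‖ * (1 + ‖(1 : A)‖) * ‖resolvent a z‖ := by
  calc ‖(z - z₀) • resolvent a z - 1‖
      ≤ ‖z - z₀‖ * ‖resolvent a z‖ + 1 * ‖(1 : A)‖ := by
        rw [one_mul, ← norm_smul]; exact norm_sub_le _ _
    _ ≤ ‖z - z₀‖ * ‖resolvent a z‖ + ‖z - z₀‖ * ‖resolvent a z‖ * ‖(1 : A)‖ := by
        gcongr; exact one_le_norm_sub_mul_norm_resolvent hz₀ hz
    _ = ‖z - z₀‖ * (1 + ‖(1 : A)‖) * ‖resolvent a z‖ := by ring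

/-- Normalised resolvents at nearby points off the spectrum are approximate eigenvectors. -/
theorem exists_approximate_eigenvector (hz₀ : z₀ ∈ frontier (spectrum ℂ a)) {ε : ℝ}
    (hε : 0 < ε) :
    ∃ y : A, ‖y‖ = 1 ∧ ‖(a - algebraMap ℂ A z₀) * y‖ ≤ ε ∧ ‖y * (a - algebraMap ℂ A z₀)‖ ≤ ε := by
  have hσ : z₀ ∈ spectrum ℂ a := (spectrum.isClosed a).frontier_subset hz₀
  obtain ⟨z, hz, hzz₀⟩ : ∃ z ∉ spectrum ℂ a, ‖z - z₀‖ * (1 + ‖(1 : A)‖) < ε := by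
    have hcl : z₀ ∈ closure (spectrum ℂ a)ᶜ := (frontier_eq_closure_inter_closure.subset hz₀).2
    obtain ⟨z, hz, hlt⟩ := Metric.mem_closure_iff.mp hcl (ε / (1 + ‖(1 : A)‖)) (by positivity)
    exact ⟨z, hz, by rwa [← lt_div_iff₀ (by positivity), ← dist_eq_norm, dist_comm]⟩
  set R := resolvent a z
  have hR : 0 < ‖R‖ := pos_of_mul_pos_right
    (zero_lt_one.trans_le (one_le_norm_sub_mul_norm_resolvent hσ hz)) (norm_nonneg _)
  have hnorm (x : A) : ‖((‖R‖⁻¹ : ℝ) : ℂ) • x‖ = ‖R‖⁻¹ * ‖x‖ := by simp [norm_smul]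
  have hsmall : ‖((‖R‖⁻¹ : ℝ) : ℂ) • ((z - z₀) • R - 1)‖ ≤ ε := by
    rw [hnorm, inv_mul_le_iff₀ hR, mul_comm]
    exact (norm_smul_resolvent_sub_one_le hσ hz).trans (by gcongr)
  refine ⟨((‖R‖⁻¹ : ℝ) : ℂ) • R, by rw [hnorm, inv_mul_cancel₀ hR.ne'], ?_, ?_⟩
  · rwa [mul_smul_comm, sub_algebraMap_mul_resolvent hz]
  · rwa [smul_mul_assoc, resolvent_mul_sub_algebraMap hz]

end ApproximateEigenvector

/-! ### Slice maps -/

section Slice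

variable {A B C : Type*} [NormedRing A] [NormedAlgebra ℂ A] [NormedRing B] [NormedAlgebra ℂ B]
  [NormedRing C] [NormedAlgebra ℂ C]

/-- A homomorphism from `A ⊗ B` onto a dense subalgebra of `C` that pulls the norm of `C` back to a
uniform crossnorm. In this form the roles of `A` and `B` can be interchanged. -/
structure IsUniformCrossEmbedding (e : A ⊗[ℂ] B →ₐ[ℂ] C) : Prop where
  denseRange : DenseRange e
  cross : ∀ (a : A) (b : B), ‖e (a ⊗ₜ[ℂ] b)‖ = ‖a‖ * ‖b‖
  uniform : ∀ (S : A →L[ℂ] A) (T : B →L[ℂ] B) (w : A ⊗[ℂ] B),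
    ‖e (TensorProduct.map (S : A →ₗ[ℂ] A) (T : B →ₗ[ℂ] B) w)‖ ≤ ‖S‖ * ‖T‖ * ‖e w‖

/-- The slice map `id ⊗ g : A ⊗ B → A` on the algebraic tensor product. -/
noncomputable def sliceTensor (g : B →L[ℂ] ℂ) : A ⊗[ℂ] B →ₗ[ℂ] A :=
  (TensorProduct.rid ℂ A).toLinearMap ∘ₗ TensorProduct.map LinearMap.id (g : B →ₗ[ℂ] ℂ)

/-- The continuous extension to `C` of the slice map `id ⊗ g`. -/
noncomputable def slice [CompleteSpace A] (e : A ⊗[ℂ] B →ₐ[ℂ] C) (g : B →L[ℂ] ℂ) : C →L[ℂ] A :=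
  (sliceTensor g).extendOfNorm e.toLinearMap

theorem sliceTensor_tmul (g : B →L[ℂ] ℂ) (x : A) (y : B) :
    sliceTensor g (x ⊗ₜ[ℂ] y) = g y • x := by
  simp [sliceTensor]

theorem sliceTensor_tmul_one_mul (g : B →L[ℂ] ℂ) (x : A) (w : A ⊗[ℂ] B) :
    sliceTensor g (x ⊗ₜ[ℂ] 1 * w) = x * sliceTensor g w := by
  induction w with
  | zero => simp
  | tmul u v => simp [sliceTensor_tmul]
  | add u v hu hv => rw [mul_add, map_add, hu, hv, map_add, mul_add]

theorem sliceTensor_mul_tmul_one (g : B →L[ℂ] ℂ) (x : A) (w : A ⊗[ℂ] B) :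
    sliceTensor g (w * x ⊗ₜ[ℂ] 1) = sliceTensor g w * x := by
  induction w with
  | zero => simp
  | tmul u v => simp [sliceTensor_tmul]
  | add u v hu hv => rw [add_mul, map_add, hu, hv, map_add, add_mul]

theorem sliceTensor_tmul_one (g : B →L[ℂ] ℂ) (w : A ⊗[ℂ] B) :
    sliceTensor g w ⊗ₜ[ℂ] (1 : B) = TensorProduct.map (ContinuousLinearMap.id ℂ A : A →ₗ[ℂ] A)
      (g.smulRight (1 : B) : B →ₗ[ℂ] B) w := by
  induction w with
  | zero => simp
  | tmul x y => simp [sliceTensor_tmul, TensorProduct.smul_tmul]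
  | add u v hu hv => rw [map_add, TensorProduct.add_tmul, hu, hv, map_add]

namespace IsUniformCrossEmbedding

variable {e : A ⊗[ℂ] B →ₐ[ℂ] C}

theorem symm (h : IsUniformCrossEmbedding e) :
    IsUniformCrossEmbedding (e.comp (Algebra.TensorProduct.comm ℂ B A : B ⊗[ℂ] A →ₐ[ℂ] A ⊗[ℂ] B))
    where
  denseRange := by
    rw [AlgHom.coe_comp, DenseRange, AlgEquiv.coe_toAlgHom,
      (Algebra.TensorProduct.comm ℂ B A).surjective.range_comp e]
    exact h.denseRange
  cross b a := by simp [h.cross, mul_comm]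
  uniform T S w := by
    have hmap := TensorProduct.map_comm (S : A →ₗ[ℂ] A) (T : B →ₗ[ℂ] B) w
    rw [mul_comm ‖T‖]
    exact (congrArg (‖e ·‖) hmap).symm.trans_le (h.uniform S T (Algebra.TensorProduct.comm ℂ B A w))

theorem norm_sliceTensor_le [Nontrivial B] (h : IsUniformCrossEmbedding e) (g : B →L[ℂ] ℂ)
    (w : A ⊗[ℂ] B) : ‖sliceTensor g w‖ ≤ ‖g‖ * ‖e w‖ := by
  have hone : 0 < ‖(1 : B)‖ := norm_pos_iff.mpr one_ne_zero
  refine le_of_mul_le_mul_right ?_ hone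
  calc ‖sliceTensor g w‖ * ‖(1 : B)‖
      = ‖e (TensorProduct.map (ContinuousLinearMap.id ℂ A : A →ₗ[ℂ] A)
          (g.smulRight (1 : B) : B →ₗ[ℂ] B) w)‖ := by rw [← sliceTensor_tmul_one, h.cross]
    _ ≤ ‖ContinuousLinearMap.id ℂ A‖ * ‖g.smulRight (1 : B)‖ * ‖e w‖ := h.uniform _ _ _
    _ ≤ 1 * (‖g‖ * ‖(1 : B)‖) * ‖e w‖ := by
        gcongr
        · exact ContinuousLinearMap.norm_id_le
        · exact (ContinuousLinearMap.norm_smulRight_apply g 1).le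
    _ = ‖g‖ * ‖e w‖ * ‖(1 : B)‖ := by ring

variable [CompleteSpace A] [Nontrivial B]

theorem slice_apply (h : IsUniformCrossEmbedding e) (g : B →L[ℂ] ℂ) (w : A ⊗[ℂ] B) :
    slice e g (e w) = sliceTensor g w :=
  LinearMap.extendOfNorm_eq h.denseRange ⟨‖g‖, h.norm_sliceTensor_le g⟩ w

theorem norm_slice_apply_le (h : IsUniformCrossEmbedding e) (g : B →L[ℂ] ℂ) (c : C) :
    ‖slice e g c‖ ≤ ‖g‖ * ‖c‖ :=
  LinearMap.norm_extendOfNorm_apply_le h.denseRange _ (h.norm_sliceTensor_le g) c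

theorem slice_tmul (h : IsUniformCrossEmbedding e) (g : B →L[ℂ] ℂ) (x : A) (y : B) :
    slice e g (e (x ⊗ₜ y)) = g y • x := by
  rw [h.slice_apply, sliceTensor_tmul]

theorem slice_tmul_one_mul (h : IsUniformCrossEmbedding e) (g : B →L[ℂ] ℂ) (x : A) (c : C) :
    slice e g (e (x ⊗ₜ 1) * c) = x * slice e g c := by
  refine h.denseRange.induction_on c (isClosed_eq (by fun_prop) (by fun_prop)) fun w => ?_
  rw [← map_mul, h.slice_apply, h.slice_apply, sliceTensor_tmul_one_mul]

theorem slice_mul_tmul_one (h : IsUniformCrossEmbedding e) (g : B →L[ℂ] ℂ) (x : A) (c : C) :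
    slice e g (c * e (x ⊗ₜ 1)) = slice e g c * x := by
  refine h.denseRange.induction_on c (isClosed_eq (by fun_prop) (by fun_prop)) fun w => ?_
  rw [← map_mul, h.slice_apply, h.slice_apply, sliceTensor_mul_tmul_one]

end IsUniformCrossEmbedding

end Slice

/-! ### The spectrum of an elementary tensor -/

/-- Moving `(l, m)` along the hyperbola `{(l', m') | l' * m' = l * m}` until `‖l'‖` is maximal. -/
theorem exists_mem_frontier_mul_eq {K L : Set ℂ} (hK : IsCompact K) (hL : IsCompact L) {l m : ℂ}
    (hl : l ∈ K) (hm : m ∈ L) (hlm : l * m ≠ 0) :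
    ∃ l' ∈ K, ∃ m' ∈ L, l' * m' = l * m ∧ (l' ∈ frontier K ∨ m' ∈ frontier L) := by
  have hF : IsCompact (K ×ˢ L ∩ {p : ℂ × ℂ | p.1 * p.2 = l * m}) :=
    (hK.prod hL).inter_right (isClosed_eq (by fun_prop) (by fun_prop))
  obtain ⟨⟨l', m'⟩, ⟨⟨hl', hm'⟩, hlm' : l' * m' = l * m⟩, hmax⟩ :=
    hF.exists_isMaxOn ⟨(l, m), ⟨hl, hm⟩, rfl⟩ (continuous_norm.comp continuous_fst).continuousOn
  refine ⟨l', hl', m', hm', hlm', ?_⟩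
  by_contra! hfr
  rw [hK.isClosed.frontier_eq, hL.isClosed.frontier_eq] at hfr
  have hlK : K ∈ 𝓝 l' := mem_interior_iff_mem_nhds.mp (by simpa [hl'] using hfr.1)
  have hmL : L ∈ 𝓝 m' := mem_interior_iff_mem_nhds.mp (by simpa [hm'] using hfr.2)
  have hl_cont : Tendsto (fun t : ℝ => (t : ℂ) * l') (𝓝 1) (𝓝 l') := by
    simpa using (Complex.continuous_ofReal.tendsto 1).mul_const l'
  have hm_cont : Tendsto (fun t : ℝ => (t : ℂ)⁻¹ * m') (𝓝 1) (𝓝 m') := by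
    simpa using ((Complex.continuous_ofReal.tendsto 1).inv₀ (by simp)).mul_const m'
  obtain ⟨t, ⟨htK, htL⟩, ht : 1 < t⟩ :=
    (((hl_cont.eventually_mem hlK).and (hm_cont.eventually_mem hmL)).filter_mono
      nhdsWithin_le_nhds |>.and (self_mem_nhdsWithin (s := Set.Ioi (1 : ℝ)))).exists
  have hl0 : 0 < ‖l'‖ := norm_pos_iff.mpr (left_ne_zero_of_mul (hlm' ▸ hlm))
  have ht0 : (t : ℂ) ≠ 0 := Complex.ofReal_ne_zero.mpr (zero_lt_one.trans ht).ne'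
  have hle : ‖(t : ℂ) * l'‖ ≤ ‖l'‖ :=
    hmax (a := ((t : ℂ) * l', (t : ℂ)⁻¹ * m')) ⟨⟨htK, htL⟩,
      by rw [Set.mem_ofPred_eq, mul_mul_mul_comm, mul_inv_cancel₀ ht0, one_mul, hlm']⟩
  rw [norm_mul, Complex.norm_of_nonneg (zero_le_one.trans ht.le)] at hle
  exact hle.not_gt (lt_mul_of_one_lt_left hl0 ht)

theorem isUnit_of_norm_mul_sub_one_lt {A : Type*} [NormedRing A] [CompleteSpace A] {a p q : A}
    (hp : ‖p * a - 1‖ < 1) (hq : ‖a * q - 1‖ < 1) : IsUnit a := by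
  have hunit {x : A} (hx : ‖x - 1‖ < 1) : IsUnit x :=
    not_not.mp fun hx' => nonunits.subset_compl_ball hx' (mem_ball_iff_norm.mpr hx)
  obtain ⟨p', hp'⟩ := (hunit hp).exists_left_inv
  obtain ⟨q', hq'⟩ := (hunit hq).exists_right_inv
  exact isUnit_iff_exists_and_exists.mpr
    ⟨⟨q * q', (mul_assoc a q q').symm.trans hq'⟩, ⟨p' * p, (mul_assoc p' p a).trans hp'⟩⟩

section Tensor

variable {A B C : Type*} [NormedRing A] [NormedAlgebra ℂ A] [NormedRing B] [NormedAlgebra ℂ B]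
  [NormedRing C] [NormedAlgebra ℂ C] {e : A ⊗[ℂ] B →ₐ[ℂ] C} {a : A} {b : B}

theorem isStronglyPiRegular_tmul (e : A ⊗[ℂ] B →ₐ[ℂ] C) (ha : IsStronglyPiRegular a)
    (hb : IsStronglyPiRegular b) : IsStronglyPiRegular (e (a ⊗ₜ b)) := by
  obtain ⟨n, y, z, hy, hz⟩ := ha
  obtain ⟨k, y', z', hy', hz'⟩ := hb
  have hn := le_max_left n k
  have hk := le_max_right n k
  refine ⟨max n k, e (y ⊗ₜ y'), e (z ⊗ₜ z'), ?_, ?_⟩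
  · simp only [← map_pow, ← map_mul, Algebra.TensorProduct.tmul_pow,
      Algebra.TensorProduct.tmul_mul_tmul, pow_succ_mul_of_le hy hn, pow_succ_mul_of_le hy' hk]
  · simp only [← map_pow, ← map_mul, Algebra.TensorProduct.tmul_pow,
      Algebra.TensorProduct.tmul_mul_tmul, mul_pow_succ_of_le hz hn, mul_pow_succ_of_le hz' hk]

theorem spectrum_tmul_subset [CompleteSpace C] (e : A ⊗[ℂ] B →ₐ[ℂ] C) (a : A) (b : B) :
    spectrum ℂ (e (a ⊗ₜ b)) ⊆ spectrum ℂ a * spectrum ℂ b := by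
  have hcomm : Commute (e (a ⊗ₜ 1)) (e (1 ⊗ₜ b)) :=
    Commute.map (show Commute (a ⊗ₜ[ℂ] (1 : B)) (1 ⊗ₜ b) by simp [Commute, SemiconjBy]) e
  have hmul : e (a ⊗ₜ b) = e (a ⊗ₜ 1) * e (1 ⊗ₜ b) := by rw [← map_mul]; simp
  rw [hmul]
  exact (spectrum_mul_subset hcomm).trans (Set.mul_subset_mul
    (AlgHom.spectrum_apply_subset (e.comp Algebra.TensorProduct.includeLeft) a)
    (AlgHom.spectrum_apply_subset (e.comp Algebra.TensorProduct.includeRight) b))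

namespace IsUniformCrossEmbedding

theorem tmul_eq_zero_iff (h : IsUniformCrossEmbedding e) :
    e (a ⊗ₜ b) = 0 ↔ a = 0 ∨ b = 0 := by
  rw [← norm_eq_zero, h.cross, mul_eq_zero, norm_eq_zero, norm_eq_zero]

theorem nontrivial [Nontrivial A] [Nontrivial B] (h : IsUniformCrossEmbedding e) : Nontrivial C :=
  ⟨e ((1 : A) ⊗ₜ (1 : B)), 0, fun h0 => (h.tmul_eq_zero_iff.mp h0).elim one_ne_zero one_ne_zero⟩

theorem isNilpotent_tmul_iff (h : IsUniformCrossEmbedding e) :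
    IsNilpotent (e (a ⊗ₜ b)) ↔ IsNilpotent a ∨ IsNilpotent b := by
  simp only [IsNilpotent, ← map_pow, Algebra.TensorProduct.tmul_pow, h.tmul_eq_zero_iff, exists_or]

theorem isUnit_left [CompleteSpace A] [Nontrivial B] (h : IsUniformCrossEmbedding e)
    (hu : IsUnit (e (a ⊗ₜ b))) : IsUnit a := by
  obtain ⟨w, hw, hw'⟩ := isUnit_iff_exists.mp hu
  obtain ⟨g, hg⟩ := SeparatingDual.exists_eq_one (R := ℂ) (one_ne_zero (α := B))
  have h1 : slice e g 1 = 1 := by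
    rw [← map_one e, Algebra.TensorProduct.one_def, h.slice_tmul, hg, one_smul]
  have hr : a * slice e g (e (1 ⊗ₜ b) * w) = 1 := by
    rw [← h.slice_tmul_one_mul, ← mul_assoc, ← map_mul]; simp [hw, h1]
  have hl : slice e g (w * e (1 ⊗ₜ b)) * a = 1 := by
    rw [← h.slice_mul_tmul_one, mul_assoc, ← map_mul]; simp [hw', h1]
  exact isUnit_iff_exists_and_exists.mpr ⟨⟨_, hr⟩, ⟨_, hl⟩⟩

theorem norm_mul_slice_sub_one_le [CompleteSpace A] [Nontrivial B] (h : IsUniformCrossEmbedding e)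
    {l m : ℂ} {w : C} (hw : (algebraMap ℂ C (l * m) - e (a ⊗ₜ b)) * w = 1) {g : B →L[ℂ] ℂ} {y : B}
    (hgy : g y = 1) :
    ‖(algebraMap ℂ A l - a) * (m • slice e g (e (1 ⊗ₜ y) * w)) - 1‖ ≤
      ‖g‖ * (‖a‖ * ‖y * (b - algebraMap ℂ B m)‖ * ‖w‖) := by
  have hsplit : e (1 ⊗ₜ y) * (algebraMap ℂ C (l * m) - e (a ⊗ₜ b)) =
      m • (e ((algebraMap ℂ A l - a) ⊗ₜ 1) * e (1 ⊗ₜ y)) -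
        e (a ⊗ₜ (y * (b - algebraMap ℂ B m))) := by
    rw [← e.commutes, ← map_sub, ← map_mul, ← map_mul, ← map_smul, ← map_sub]
    congr 1
    simp [Algebra.algebraMap_eq_smul_one, Algebra.TensorProduct.one_def, mul_sub, sub_mul, smul_sub,
      TensorProduct.sub_tmul, TensorProduct.tmul_sub, TensorProduct.smul_tmul', mul_smul,
      smul_comm m l]
  have hslice : 1 = (algebraMap ℂ A l - a) * (m • slice e g (e (1 ⊗ₜ y) * w)) -
      slice e g (e (a ⊗ₜ (y * (b - algebraMap ℂ B m))) * w) := by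
    have hy : e (1 ⊗ₜ y) = m • (e ((algebraMap ℂ A l - a) ⊗ₜ 1) * (e (1 ⊗ₜ y) * w)) -
        e (a ⊗ₜ (y * (b - algebraMap ℂ B m))) * w := by
      rw [← mul_assoc, ← smul_mul_assoc, ← sub_mul, ← hsplit, mul_assoc, hw, mul_one]
    have := congrArg (slice e g) hy
    rwa [h.slice_tmul, hgy, one_smul, map_sub, map_smul, h.slice_tmul_one_mul,
      ← mul_smul_comm] at this
  rw [sub_eq_iff_eq_add'.mp hslice.symm, add_sub_cancel_right]
  refine (h.norm_slice_apply_le g _).trans (mul_le_mul_of_nonneg_left ?_ (norm_nonneg g))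
  exact (norm_mul_le _ _).trans_eq (by rw [h.cross])

theorem norm_slice_mul_sub_one_le [CompleteSpace A] [Nontrivial B] (h : IsUniformCrossEmbedding e)
    {l m : ℂ} {w : C} (hw : w * (algebraMap ℂ C (l * m) - e (a ⊗ₜ b)) = 1) {g : B →L[ℂ] ℂ} {y : B}
    (hgy : g y = 1) :
    ‖(m • slice e g (w * e (1 ⊗ₜ y))) * (algebraMap ℂ A l - a) - 1‖ ≤
      ‖g‖ * (‖w‖ * (‖a‖ * ‖(b - algebraMap ℂ B m) * y‖)) := by
  have hsplit : (algebraMap ℂ C (l * m) - e (a ⊗ₜ b)) * e (1 ⊗ₜ y) =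
      m • (e (1 ⊗ₜ y) * e ((algebraMap ℂ A l - a) ⊗ₜ 1)) -
        e (a ⊗ₜ ((b - algebraMap ℂ B m) * y)) := by
    rw [← e.commutes, ← map_sub, ← map_mul, ← map_mul, ← map_smul, ← map_sub]
    congr 1
    simp [Algebra.algebraMap_eq_smul_one, Algebra.TensorProduct.one_def, mul_sub, sub_mul, smul_sub,
      TensorProduct.sub_tmul, TensorProduct.tmul_sub, TensorProduct.smul_tmul', mul_smul,
      smul_comm m l]
  have hslice : 1 = (m • slice e g (w * e (1 ⊗ₜ y))) * (algebraMap ℂ A l - a) -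
      slice e g (w * e (a ⊗ₜ ((b - algebraMap ℂ B m) * y))) := by
    have hy : e (1 ⊗ₜ y) = m • ((w * e (1 ⊗ₜ y)) * e ((algebraMap ℂ A l - a) ⊗ₜ 1)) -
        w * e (a ⊗ₜ ((b - algebraMap ℂ B m) * y)) := by
      rw [mul_assoc, ← mul_smul_comm, ← mul_sub, ← hsplit, ← mul_assoc, hw, one_mul]
    have := congrArg (slice e g) hy
    rwa [h.slice_tmul, hgy, one_smul, map_sub, map_smul, h.slice_mul_tmul_one,
      ← smul_mul_assoc] at this
  rw [sub_eq_iff_eq_add'.mp hslice.symm, add_sub_cancel_right]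
  refine (h.norm_slice_apply_le g _).trans (mul_le_mul_of_nonneg_left ?_ (norm_nonneg g))
  exact (norm_mul_le _ _).trans_eq (by rw [h.cross])

theorem mul_mem_spectrum_tmul_of_mem_frontier [CompleteSpace A] [CompleteSpace B] [Nontrivial B]
    (h : IsUniformCrossEmbedding e) {l m : ℂ} (hl : l ∈ spectrum ℂ a)
    (hm : m ∈ frontier (spectrum ℂ b)) : l * m ∈ spectrum ℂ (e (a ⊗ₜ b)) := by
  intro hu
  obtain ⟨w, hright, hleft⟩ := isUnit_iff_exists.mp hu
  obtain ⟨ε, hε, hε1⟩ : ∃ ε > 0, (‖w‖ * ‖a‖) * ε < 1 :=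
    exists_pos_mul_lt one_pos _
  obtain ⟨y, hy, hly, hry⟩ := exists_approximate_eigenvector hm hε
  obtain ⟨g, hg, hgy⟩ := exists_dual_vector ℂ y (by simp [hy])
  replace hgy : g y = 1 := by simp [hgy, hy]
  refine hl (isUnit_of_norm_mul_sub_one_lt
    ((h.norm_slice_mul_sub_one_le hleft hgy).trans_lt ?_)
    ((h.norm_mul_slice_sub_one_le hright hgy).trans_lt ?_))
  · calc ‖g‖ * (‖w‖ * (‖a‖ * ‖(b - algebraMap ℂ B m) * y‖)) ≤ 1 * (‖w‖ * (‖a‖ * ε)) := by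
          rw [hg]; gcongr
      _ < 1 := by rwa [one_mul, ← mul_assoc]
  · calc ‖g‖ * (‖a‖ * ‖y * (b - algebraMap ℂ B m)‖ * ‖w‖) ≤ 1 * (‖a‖ * ε * ‖w‖) := by
          rw [hg]; gcongr
      _ < 1 := by rwa [one_mul, mul_comm, ← mul_assoc]

theorem isUnit_right [CompleteSpace B] [Nontrivial A] (h : IsUniformCrossEmbedding e)
    (hu : IsUnit (e (a ⊗ₜ b))) : IsUnit b :=
  h.symm.isUnit_left (by simpa using hu)

theorem isStronglyPiRegular_left [CompleteSpace A] [Nontrivial B] (h : IsUniformCrossEmbedding e)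
    (hb : ¬ IsNilpotent b) (hab : IsStronglyPiRegular (e (a ⊗ₜ b))) : IsStronglyPiRegular a := by
  obtain ⟨n, y, z, hy, hz⟩ := hab
  obtain ⟨g, hg⟩ := SeparatingDual.exists_eq_one (R := ℂ) fun hbn => hb ⟨n, hbn⟩
  have hn : slice e g (e (a ⊗ₜ b) ^ n) = a ^ n := by
    rw [← map_pow, Algebra.TensorProduct.tmul_pow, h.slice_tmul, hg, one_smul]
  have hpow : e (a ⊗ₜ b) ^ (n + 1) = e ((a ^ (n + 1)) ⊗ₜ (b ^ (n + 1))) := by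
    rw [← map_pow, Algebra.TensorProduct.tmul_pow]
  refine ⟨n, slice e g (e (1 ⊗ₜ (b ^ (n + 1))) * y), slice e g (z * e (1 ⊗ₜ (b ^ (n + 1)))), ?_, ?_⟩
  · rw [← h.slice_tmul_one_mul, ← mul_assoc, ← map_mul, Algebra.TensorProduct.tmul_mul_tmul,
      mul_one, one_mul, ← hpow, hy, hn]
  · rw [← h.slice_mul_tmul_one, mul_assoc, ← map_mul, Algebra.TensorProduct.tmul_mul_tmul,
      mul_one, one_mul, ← hpow, hz, hn]

theorem isStronglyPiRegular_right [CompleteSpace B] [Nontrivial A] (h : IsUniformCrossEmbedding e)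
    (ha : ¬ IsNilpotent a) (hab : IsStronglyPiRegular (e (a ⊗ₜ b))) : IsStronglyPiRegular b :=
  h.symm.isStronglyPiRegular_left ha (by simpa using hab)

theorem zero_mem_poles_tmul [CompleteSpace A] [CompleteSpace C] [Nontrivial B]
    (h : IsUniformCrossEmbedding e) (ha : 0 ∈ poles a) (hb : IsStronglyPiRegular b) :
    0 ∈ poles (e (a ⊗ₜ b)) := by
  rw [zero_mem_poles_iff] at ha ⊢
  exact ⟨fun hu => ha.1 (h.isUnit_left hu), isStronglyPiRegular_tmul e ha.2 hb⟩

variable [CompleteSpace A] [CompleteSpace B] [Nontrivial A] [Nontrivial B]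

theorem mul_subset_spectrum_tmul (h : IsUniformCrossEmbedding e) :
    spectrum ℂ a * spectrum ℂ b ⊆ spectrum ℂ (e (a ⊗ₜ b)) := by
  rintro _ ⟨l, hl, m, hm, rfl⟩
  rcases eq_or_ne (l * m) 0 with hlm | hlm
  · simp only [hlm]
    refine (spectrum.zero_mem_iff ℂ).mpr fun hu => ?_
    rcases mul_eq_zero.mp hlm with rfl | rfl
    · exact (spectrum.zero_mem_iff ℂ).mp hl (h.isUnit_left hu)
    · exact (spectrum.zero_mem_iff ℂ).mp hm (h.isUnit_right hu)
  · obtain ⟨l', hl', m', hm', heq, hfr⟩ := exists_mem_frontier_mul_eq (spectrum.isCompact a)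
      (spectrum.isCompact b) hl hm hlm
    simp only [← heq]
    rcases hfr with hfr | hfr
    · simpa [mul_comm m' l'] using h.symm.mul_mem_spectrum_tmul_of_mem_frontier hm' hfr
    · exact h.mul_mem_spectrum_tmul_of_mem_frontier hl' hfr

theorem spectrum_tmul [CompleteSpace C] (h : IsUniformCrossEmbedding e) :
    spectrum ℂ (e (a ⊗ₜ b)) = spectrum ℂ a * spectrum ℂ b :=
  (spectrum_tmul_subset e a b).antisymm h.mul_subset_spectrum_tmul

variable [CompleteSpace C]

theorem spectrum_tmul_eq_zero_iff (h : IsUniformCrossEmbedding e) :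
    spectrum ℂ (e (a ⊗ₜ b)) = {0} ↔ spectrum ℂ a = {0} ∨ spectrum ℂ b = {0} := by
  rw [h.spectrum_tmul, mul_eq_singleton_zero_iff (spectrum.nonempty a) (spectrum.nonempty b)]

theorem zero_mem_acc_spectrum_tmul (h : IsUniformCrossEmbedding e) (hb : spectrum ℂ b ≠ {0})
    (ha : 0 ∈ acc (spectrum ℂ a)) : 0 ∈ acc (spectrum ℂ (e (a ⊗ₜ b))) := by
  rw [mem_acc_iff] at ha
  obtain ⟨m, hm, hm0⟩ := exists_mem_ne_zero (spectrum.nonempty b) hb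
  rw [mem_acc_iff, h.spectrum_tmul]
  exact ⟨⟨0, ha.1, m, hm, zero_mul m⟩, accPt_zero_mul ha.2 hm hm0⟩

theorem zero_mem_nonpoles_tmul (h : IsUniformCrossEmbedding e) (ha : ¬ IsNilpotent a)
    (hacc : ¬ AccPt 0 (𝓟 (spectrum ℂ a))) (hb : 0 ∈ nonpoles b) :
    0 ∈ nonpoles (e (a ⊗ₜ b)) := by
  have hbu : ¬ IsUnit b := (spectrum.zero_mem_iff ℂ).mp hb.1.1
  refine ⟨⟨(spectrum.zero_mem_iff ℂ).mpr fun hu => hbu (h.isUnit_right hu), ?_⟩, fun hp => ?_⟩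
  · rw [h.spectrum_tmul]
    exact not_accPt_zero_mul hacc hb.1.2
  · exact hb.2 (zero_mem_poles_iff.mpr
      ⟨hbu, h.isStronglyPiRegular_right ha (zero_mem_poles_iff.mp hp).2⟩)

end IsUniformCrossEmbedding

end Tensor

/-- The canonical homomorphism from `A ⊗ B` to its completion with respect to `α`. -/
noncomputable def ofTensor {A B : Type*} [NormedRing A] [NormedAlgebra ℂ A] [NormedRing B]
    [NormedAlgebra ℂ B] (α : AlgebraNorm ℂ (A ⊗[ℂ] B)) : A ⊗[ℂ] B →ₐ[ℂ] CompletedTensor α where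
  toRingHom := UniformSpace.Completion.coeRingHom.comp
    (NormedTensor.of α : (A ⊗[ℂ] B) →+* NormedTensor α)
  commutes' _ := rfl

theorem IsUniformCrossnorm.isUniformCrossEmbedding {A B : Type*} [NormedRing A] [NormedAlgebra ℂ A]
    [NormedRing B] [NormedAlgebra ℂ B] {α : AlgebraNorm ℂ (A ⊗[ℂ] B)} (hα : IsUniformCrossnorm α) :
    IsUniformCrossEmbedding (ofTensor α) := by
  have hnorm (w : A ⊗[ℂ] B) : ‖ofTensor α w‖ = α w := UniformSpace.Completion.norm_coe _
  refine ⟨?_, fun a b => (hnorm _).trans (hα.cross a b), fun S T w => ?_⟩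
  · exact UniformSpace.Completion.denseRange_coe.comp
      (NormedTensor.of α).surjective.denseRange (UniformSpace.Completion.continuous_coe _)
  · rw [hnorm, hnorm]
    exact hα.uniform S T w

end TensorSpectrum

theorem theorem3p2 {A : Type*} {B : Type*}
    [NormedRing A] [NormedAlgebra ℂ A] [CompleteSpace A] [Nontrivial A]
    [NormedRing B] [NormedAlgebra ℂ B] [CompleteSpace B] [Nontrivial B]
    (α : AlgebraNorm ℂ (A ⊗[ℂ] B)) (hα : TensorSpectrum.IsUniformCrossnorm α) (a : A) (b : B) :
    -- (i)
    (((spectrum ℂ a = {0} ∧ TensorSpectrum.poles a = {0}) ∨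
        (spectrum ℂ b = {0} ∧ TensorSpectrum.poles b = {0})) ↔
      (spectrum ℂ (TensorSpectrum.tmul α a b) = {0} ∧
        TensorSpectrum.poles (TensorSpectrum.tmul α a b) = {0})) ∧
    -- (ii)
    (¬ IsNilpotent a → ¬ IsNilpotent b →
      (((spectrum ℂ a = {0} ∧ TensorSpectrum.nonpoles a = {0}) ∨
          (spectrum ℂ b = {0} ∧ TensorSpectrum.nonpoles b = {0})) ↔
        (spectrum ℂ (TensorSpectrum.tmul α a b) = {0} ∧
          TensorSpectrum.nonpoles (TensorSpectrum.tmul α a b) = {0}))) ∧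
    -- (iii)
    ((0 ∈ TensorSpectrum.poles a ∧ IsUnit b) ∨ (0 ∈ TensorSpectrum.poles b ∧ IsUnit a) ∨
        (0 ∈ TensorSpectrum.poles a ∩ TensorSpectrum.poles b) →
      0 ∈ TensorSpectrum.poles (TensorSpectrum.tmul α a b)) ∧
    -- (iv)
    ((¬ IsNilpotent a → 0 ∈ TensorSpectrum.poles a → 0 ∈ TensorSpectrum.nonpoles b →
        0 ∈ TensorSpectrum.nonpoles (TensorSpectrum.tmul α a b)) ∧
      (¬ IsNilpotent b → 0 ∈ TensorSpectrum.poles b → 0 ∈ TensorSpectrum.nonpoles a →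
        0 ∈ TensorSpectrum.nonpoles (TensorSpectrum.tmul α a b))) ∧
    -- (v)
    ((IsUnit b → 0 ∈ TensorSpectrum.nonpoles a →
        0 ∈ TensorSpectrum.nonpoles (TensorSpectrum.tmul α a b)) ∧
      (IsUnit a → 0 ∈ TensorSpectrum.nonpoles b →
        0 ∈ TensorSpectrum.nonpoles (TensorSpectrum.tmul α a b))) ∧
    -- (vi)
    (0 ∈ TensorSpectrum.nonpoles a ∩ TensorSpectrum.nonpoles b →
      0 ∈ TensorSpectrum.nonpoles (TensorSpectrum.tmul α a b)) ∧
    -- (vii)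
    ((spectrum ℂ b ≠ {0} → 0 ∈ TensorSpectrum.acc (spectrum ℂ a) →
        0 ∈ TensorSpectrum.acc (spectrum ℂ (TensorSpectrum.tmul α a b))) ∧
      (spectrum ℂ a ≠ {0} → 0 ∈ TensorSpectrum.acc (spectrum ℂ b) →
        0 ∈ TensorSpectrum.acc (spectrum ℂ (TensorSpectrum.tmul α a b)))) := by
  have h := hα.isUniformCrossEmbedding
  have : Nontrivial (TensorSpectrum.CompletedTensor α) := h.nontrivial
  have hnil : IsNilpotent (TensorSpectrum.tmul α a b) ↔ IsNilpotent a ∨ IsNilpotent b :=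
    h.isNilpotent_tmul_iff
  refine ⟨?_, fun ha hb => ?_, ?_, ⟨fun ha hpa => ?_, fun hb hpb => ?_⟩,
    ⟨fun hb => ?_, fun ha => ?_⟩, fun ⟨ha, hb⟩ => ?_, h.zero_mem_acc_spectrum_tmul,
    h.symm.zero_mem_acc_spectrum_tmul⟩
  · simp only [← TensorSpectrum.isNilpotent_iff_spectrum_and_poles_eq_zero, hnil]
  · rw [TensorSpectrum.spectrum_eq_zero_and_nonpoles_eq_zero_iff ha,
      TensorSpectrum.spectrum_eq_zero_and_nonpoles_eq_zero_iff hb,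
      TensorSpectrum.spectrum_eq_zero_and_nonpoles_eq_zero_iff (by simp [hnil, ha, hb])]
    exact h.spectrum_tmul_eq_zero_iff.symm
  · rintro (⟨ha, hb⟩ | ⟨hb, ha⟩ | ⟨ha, hb⟩)
    · exact h.zero_mem_poles_tmul ha (TensorSpectrum.isStronglyPiRegular_of_isUnit hb)
    · exact h.symm.zero_mem_poles_tmul hb (TensorSpectrum.isStronglyPiRegular_of_isUnit ha)
    · exact h.zero_mem_poles_tmul ha (TensorSpectrum.zero_mem_poles_iff.mp hb).2
  · exact h.zero_mem_nonpoles_tmul ha (TensorSpectrum.poles_subset_iso a hpa).2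
  · exact h.symm.zero_mem_nonpoles_tmul hb (TensorSpectrum.poles_subset_iso b hpb).2
  · exact h.symm.zero_mem_nonpoles_tmul (fun hn => hn.not_isUnit hb)
      (TensorSpectrum.not_accPt_zero_spectrum_of_isUnit hb)
  · exact h.zero_mem_nonpoles_tmul (fun hn => hn.not_isUnit ha)
      (TensorSpectrum.not_accPt_zero_spectrum_of_isUnit ha)
  · exact h.zero_mem_nonpoles_tmul (TensorSpectrum.not_isNilpotent_of_zero_mem_nonpoles ha)
      ha.1.2 hb
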